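/- For natural numbers $n, m$, let $\mathcal{C}(K_m,n)$ be the following game. Two players, Maker and Breaker, alternately claim previously unclaimed edges of the complete graph $K_n$. On each of her turns Maker claims exactly one unclaimed edge; on each of his turns Breaker claims a (possibly empty) set of unclaimed edges which forms a subgraph of a clique $K_m$, that is, all edges claimed in that turn have their endpoints in a common set of at most $m$ vertices. The game ends when no unclaimed edge is left. Maker wins if the edges she has claimed contain a spanning tree of $K_n$; otherwise Breaker wins. Fix which of the two players makes the first move (either choice is allowed). A number $m_0(n)$ is the threshold bias of the game if Maker has a winning strategy in $\mathcal{C}(K_m,n)$ for every $m \le m_0(n)$ and Breaker has a winning strategy in $\mathcal{C}(K_m,n)$ for every $m > m_0(n)$. Then, for all sufficiently large $n$, the threshold bias $m_0(n)$ exists, and $$m_0(n) = \Theta\left(\sqrt{\frac{n}{\ln n}}\right) \qquad (n \to \infty).$$ -/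

import Mathlib

namespace MakerBreaker

inductive Player
  | maker
  | breaker

/-- A position of a Maker-Breaker game played on the edges of the complete graph on `Fin n`:
the edges claimed so far by each player, and the player whose turn it is. -/
structure Position (n : ℕ) where
  makerEdges : Finset (Sym2 (Fin n))
  breakerEdges : Finset (Sym2 (Fin n))
  turn : Player

/-- The empty board, with player `first` to move. -/
def Position.init (n : ℕ) (first : Player) : Position n := ⟨∅, ∅, first⟩

/-- The edges of `K_n` that nobody has claimed yet. The game ends when there are none. -/
def Position.free {n : ℕ} (p : Position n) : Finset (Sym2 (Fin n)) :=
  (⊤ : SimpleGraph (Fin n)).edgeFinset \ (p.makerEdges ∪ p.breakerEdges)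

/-- The legal moves of the `(1 : K_m)`-biased game. As long as there is a free edge, Maker claims
exactly one free edge on her turn, and Breaker claims on his turn a set `A` of free edges that is
the edge set of a subgraph of a clique `K_m`, i.e. all edges of `A` lie inside some set `S` of at
most `m` vertices. -/
inductive CliqueStep {n : ℕ} (m : ℕ) : Position n → Position n → Prop
  | maker (M B : Finset (Sym2 (Fin n))) (e : Sym2 (Fin n))
      (he : e ∈ (Position.mk M B Player.maker).free) :
      CliqueStep m ⟨M, B, Player.maker⟩ ⟨insert e M, B, Player.breaker⟩
  | breaker (M B A : Finset (Sym2 (Fin n))) (S : Finset (Fin n))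
      (hfree : (Position.mk M B Player.breaker).free.Nonempty)
      (hA : A ⊆ (Position.mk M B Player.breaker).free) (hS : S.card ≤ m) (hAS : A ⊆ S.sym2) :
      CliqueStep m ⟨M, B, Player.breaker⟩ ⟨M, B ∪ A, Player.maker⟩

/-- Maker has claimed all edges of some spanning tree of `K_n`. -/
def Position.HasSpanningTree {n : ℕ} (p : Position n) : Prop :=
  ∃ T : SimpleGraph (Fin n), T.IsTree ∧ T.edgeSet ⊆ (p.makerEdges : Set (Sym2 (Fin n)))

/-- The player who wins the connectivity game if it ends at `p`: Maker wins if she owns a spanning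
tree, otherwise Breaker wins. -/
def Position.WonBy {n : ℕ} (p : Position n) : Player → Prop
  | Player.maker => p.HasSpanningTree
  | Player.breaker => ¬ p.HasSpanningTree

/-- A strategy of player `P` is a rule that assigns a legal successor to every position where the
game has not ended and `P` is to move. -/
def IsStrategy {n : ℕ} (m : ℕ) (P : Player) (σ : Position n → Position n) : Prop :=
  ∀ p : Position n, p.turn = P → p.free.Nonempty → CliqueStep m p (σ p)

/-- `q` can be reached from `p` by legal moves in which `P` always follows `σ`, while the
opponent moves arbitrarily. -/
def ReachableUnder {n : ℕ} (m : ℕ) (P : Player) (σ : Position n → Position n) :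
    Position n → Position n → Prop :=
  Relation.ReflTransGen fun p q => CliqueStep m p q ∧ (p.turn = P → q = σ p)

/-- Player `P` wins the `(1 : K_m)`-biased connectivity game on `K_n` in which `first` moves first:
`P` has a strategy such that every play following it ends in a position won by `P`. (Every play is
finite, because Maker claims a new edge in each of her turns.) -/
def WinsCliqueConnectivity (n m : ℕ) (first P : Player) : Prop :=
  ∃ σ : Position n → Position n, IsStrategy m P σ ∧
    ∀ q : Position n, ReachableUnder m P σ (Position.init n first) q → q.free = ∅ → q.WonBy P

/-- `m₀` is the threshold bias of the `(1 : K_m)`-biased connectivity game on `K_n` in which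
`first` moves first. -/
def IsThresholdBias (n : ℕ) (first : Player) (m₀ : ℕ) : Prop :=
  ∀ m : ℕ, (m ≤ m₀ → WinsCliqueConnectivity n m first Player.maker) ∧
    (m₀ < m → WinsCliqueConnectivity n m first Player.breaker)

end MakerBreaker

/-! ### Invariant strategies, monotonicity in the bias, determinacy. -/

namespace MakerBreaker

/-! Write s = √(n / log n). Maker, for m ≤ s/3: she must claim an edge in every cut. A Breaker move
takes at most m² edges, so the biased Erdős–Selfridge potential with bias b = n / (8 log n) ≥ m²
applies; small cuts dominate its initial value, which is below 1/2 (`maker_wins_of_potential`,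
`potential_cuts_le`). Breaker, for m ≥ 2h with h = ⌈4s⌉: he isolates a vertex. Split the vertices
into about n/h blocks of size h and handle the blocks one by one. One clique move on 2h vertices
joins h untouched vertices to the current block, while Maker's reply touches at most 2. Each block
thus costs a factor of about 1 - 2/h, and the n/h ≤ s log n / 4 blocks leave untouched vertices at
the end (`breaker_wins`). The game is determined and Maker's winning biases are closed downwards, so
a threshold exists between the two bounds. -/

lemma exists_cliqueStep {n : ℕ} (m : ℕ) (p : Position n) (hp : p.free.Nonempty) :
    ∃ q, CliqueStep m p q := by
  obtain ⟨M, B, _ | _⟩ := p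
  · obtain ⟨e, he⟩ := hp
    exact ⟨_, CliqueStep.maker M B e he⟩
  · exact ⟨_, CliqueStep.breaker M B ∅ ∅ hp (by simp) (by simp) (by simp)⟩

lemma CliqueStep.free_nonempty {n m : ℕ} {p q : Position n} (h : CliqueStep m p q) :
    p.free.Nonempty := by
  cases h with
  | maker M B e he => exact ⟨e, he⟩
  | breaker M B A S hfree => exact hfree

lemma CliqueStep.mono {n m m' : ℕ} (hm : m ≤ m') {p q : Position n} (h : CliqueStep m p q) :
    CliqueStep m' p q := by
  cases h with
  | maker M B e he => exact .maker M B e he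
  | breaker M B A S hfree hA hS hAS => exact .breaker M B A S hfree hA (hS.trans hm) hAS

/-- A player wins if some property of positions holds at the start, can be maintained in the
player's own moves, is preserved by the opponent, and forces a win at the end. -/
lemma wins_of_invariant {n m : ℕ} {first P : Player} (Inv : Position n → Prop)
    (hinit : Inv (Position.init n first))
    (hown : ∀ p, p.turn = P → p.free.Nonempty → Inv p → ∃ q, CliqueStep m p q ∧ Inv q)
    (hopp : ∀ p q, p.turn ≠ P → CliqueStep m p q → Inv p → Inv q)
    (hend : ∀ p, p.free = ∅ → Inv p → p.WonBy P) :
    WinsCliqueConnectivity n m first P := by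
  classical
  -- A strategy must be legal at every position, so an arbitrary legal move serves where the
  -- invariant fails.
  have key : ∀ p : Position n, ∃ q, p.turn = P → p.free.Nonempty →
      CliqueStep m p q ∧ (Inv p → Inv q) := by
    intro p
    by_cases h : p.turn = P ∧ p.free.Nonempty
    · by_cases hI : Inv p
      · obtain ⟨q, hq, hq'⟩ := hown p h.1 h.2 hI
        exact ⟨q, fun _ _ => ⟨hq, fun _ => hq'⟩⟩
      · obtain ⟨q, hq⟩ := exists_cliqueStep m p h.2
        exact ⟨q, fun _ _ => ⟨hq, fun h => absurd h hI⟩⟩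
    · exact ⟨p, fun h1 h2 => absurd ⟨h1, h2⟩ h⟩
  choose σ hσ using key
  refine ⟨σ, fun p h1 h2 => (hσ p h1 h2).1, fun q hq hfree => hend q hfree ?_⟩
  clear hfree
  induction hq with
  | refl => exact hinit
  | @tail b c _ hstep ih =>
    by_cases hb : b.turn = P
    · rw [hstep.2 hb]
      exact (hσ b hb hstep.1.free_nonempty).2 ih
    · exact hopp _ _ hb hstep.1 ih

/-- The same strategy works: Maker's own moves do not depend on the bias, and a smaller bias only
removes Breaker moves. -/
lemma WinsCliqueConnectivity.maker_anti {n m m' : ℕ} {first : Player} (hm : m' ≤ m)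
    (h : WinsCliqueConnectivity n m first .maker) : WinsCliqueConnectivity n m' first .maker := by
  obtain ⟨σ, hσ, hwin⟩ := h
  refine ⟨σ, ?_, fun q hq hfree => hwin q
    (Relation.ReflTransGen.mono (fun _ _ h => ⟨h.1.mono hm, h.2⟩) _ _ hq) hfree⟩
  rintro ⟨M, B, _ | _⟩ hp hfree
  · have h := hσ _ hp hfree
    revert h
    generalize σ _ = q
    rintro ⟨⟩
    exact .maker _ _ _ ‹_›
  · cases hp

/-- The positions from which Maker can force a win. -/
inductive MakerWinning {n : ℕ} (m : ℕ) : Position n → Prop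
  | terminal (p : Position n) (hfree : p.free = ∅) (h : p.HasSpanningTree) : MakerWinning m p
  | maker (p q : Position n) (hp : p.turn = .maker) (hstep : CliqueStep m p q)
      (h : MakerWinning m q) : MakerWinning m p
  | breaker (p : Position n) (hp : p.turn = .breaker) (hfree : p.free.Nonempty)
      (h : ∀ q, CliqueStep m p q → MakerWinning m q) : MakerWinning m p

/-- Both the inductively defined set of positions that Maker can force and its complement are
invariants, one for each player. -/
lemma maker_wins_or_breaker_wins (n m : ℕ) (first : Player) :
    WinsCliqueConnectivity n m first .maker ∨ WinsCliqueConnectivity n m first .breaker := by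
  by_cases h : MakerWinning m (Position.init n first)
  · left
    refine wins_of_invariant (MakerWinning m) h ?_ ?_ ?_
    · intro p hp hfree hI
      cases hI with
      | terminal _ h0 => simp [h0] at hfree
      | maker _ q _ hstep h => exact ⟨q, hstep, h⟩
      | breaker _ hp' => rw [hp] at hp'; cases hp'
    · intro p q hp hstep hI
      cases hI with
      | terminal _ h0 => have := hstep.free_nonempty; simp [h0] at this
      | maker _ q hp' => exact absurd hp' hp
      | breaker _ hp' _ h => exact h q hstep
    · intro p hfree hI
      cases hI with
      | terminal _ _ h => exact h
      | maker _ q _ hstep _ => have := hstep.free_nonempty; simp [hfree] at this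
      | breaker _ _ h0 => simp [hfree] at h0
  · right
    refine wins_of_invariant (fun p => ¬ MakerWinning m p) h ?_ ?_ ?_
    · intro p hp hfree hI
      by_contra! hcon
      exact hI (.breaker p hp hfree hcon)
    · intro p q hp hstep hI hq
      refine hI (.maker p q ?_ hstep hq)
      cases h : p.turn with
      | maker => rfl
      | breaker => exact absurd h hp
    · intro p hfree hI htree
      exact hI (.terminal p hfree htree)

end MakerBreaker

/-! ### Breaker isolates a vertex. -/

namespace MakerBreaker
open Finset

/-- Vertex `v` cannot get a Maker edge any more. -/
def Position.Isolated {n : ℕ} (p : Position n) (v : Fin n) : Prop :=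
  (∀ e ∈ p.makerEdges, v ∉ e) ∧ ∀ u, u ≠ v → s(v, u) ∈ p.breakerEdges

lemma mem_free {n : ℕ} {p : Position n} {e : Sym2 (Fin n)} :
    e ∈ p.free ↔ ¬ e.IsDiag ∧ e ∉ p.makerEdges ∧ e ∉ p.breakerEdges := by
  simp [Position.free]

lemma not_hasSpanningTree_of_untouched {n : ℕ} (hn : 2 ≤ n) {p : Position n} {v : Fin n}
    (hv : ∀ e ∈ p.makerEdges, v ∉ e) : ¬ p.HasSpanningTree := by
  rintro ⟨T, hT, hsub⟩
  have : Nontrivial (Fin n) := Fin.nontrivial_iff_two_le.mpr hn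
  obtain ⟨u, hu⟩ := hT.1.preconnected.exists_adj_of_nontrivial v
  exact hv s(v, u) (by simpa using hsub (by simpa using hu)) (by simp)

lemma CliqueStep.isolated {n m : ℕ} {p q : Position n} {v : Fin n} (h : CliqueStep m p q)
    (hv : p.Isolated v) : q.Isolated v := by
  cases h with
  | maker M B e he =>
    refine ⟨fun f hf => ?_, hv.2⟩
    rcases mem_insert.mp hf with rfl | hf
    · intro hvf
      obtain ⟨u, rfl⟩ := Sym2.mem_iff_exists.mp hvf
      rw [mem_free] at he
      exact he.2.2 (hv.2 u fun h => he.1 (by simp [h]))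
    · exact hv.1 f hf
  | breaker M B A S hfree hA hS hAS =>
    exact ⟨hv.1, fun u hu => mem_union_left _ (hv.2 u hu)⟩

/-- `P` and `Q` are disjoint sets of vertices without Maker edges; Breaker owns all edges from `Q`
to the first `j` blocks of `h` vertices, and all edges from `P` to the first `j + 1` blocks. -/
structure Sweep {n : ℕ} (h j : ℕ) (P Q : Finset (Fin n)) (p : Position n) : Prop where
  disj : Disjoint P Q
  untouched : ∀ v ∈ P ∪ Q, ∀ e ∈ p.makerEdges, v ∉ e
  left : ∀ v ∈ P, ∀ u : Fin n, u ≠ v → (u : ℕ) < (j + 1) * h → s(v, u) ∈ p.breakerEdges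
  right : ∀ v ∈ Q, ∀ u : Fin n, u ≠ v → (u : ℕ) < j * h → s(v, u) ∈ p.breakerEdges

/-- Once `Q` is exhausted, every surviving vertex is joined to the current block, and the survivors
queue up for the next one. -/
lemma Sweep.next {n h j : ℕ} {P : Finset (Fin n)} {p : Position n} (hs : Sweep h j P ∅ p) :
    Sweep h (j + 1) ∅ P p :=
  ⟨by simp, by simpa using hs.untouched, by simp, hs.left⟩

lemma Sweep.isolated {n h j : ℕ} {P Q : Finset (Fin n)} {p : Position n} (hs : Sweep h j P Q p)
    (hj : n ≤ j * h) {v : Fin n} (hv : v ∈ P ∪ Q) : p.Isolated v := by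
  refine ⟨hs.untouched v hv, fun u hu => ?_⟩
  rcases mem_union.mp hv with hv | hv
  · exact hs.left v hv u hu (by have := u.2; nlinarith)
  · exact hs.right v hv u hu (by have := u.2; omega)

/-- The move is the clique on `G` together with block `j`, at most 2h vertices. Vertices of `G` are
untouched, so Maker owns none of the edges wanted. -/
lemma Sweep.breaker_move {n m h j : ℕ} {P Q G : Finset (Fin n)} {M B : Finset (Sym2 (Fin n))}
    (hs : Sweep h j P Q ⟨M, B, .breaker⟩) (hm : 2 * h ≤ m) (hG : G ⊆ Q) (hGh : G.card ≤ h)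
    (hfree : (Position.mk M B .breaker).free.Nonempty) :
    ∃ B', CliqueStep m ⟨M, B, .breaker⟩ ⟨M, B', .maker⟩ ∧
      Sweep h j (P ∪ G) (Q \ G) ⟨M, B', .maker⟩ := by
  classical
  let U : Finset (Fin n) := univ.filter fun u => j * h ≤ (u : ℕ) ∧ (u : ℕ) < (j + 1) * h
  have hU : U.card ≤ h := by
    have : (U.map Fin.valEmbedding).card ≤ (Finset.Ico (j * h) ((j + 1) * h)).card := by
      refine card_le_card fun x hx => ?_
      simp only [U, mem_map, mem_filter] at hx
      obtain ⟨u, hu, rfl⟩ := hx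
      simpa using hu.2
    rw [card_map, Nat.card_Ico, add_mul] at this
    omega
  let F := (Position.mk M B .breaker).free
  have hB : ∀ {e}, e ∈ B → e ∈ B ∪ F.filter (· ∈ (U ∪ G).sym2) := fun h => mem_union_left _ h
  refine ⟨B ∪ F.filter (· ∈ (U ∪ G).sym2),
    .breaker M B _ (U ∪ G) hfree (filter_subset _ _) ?_ (fun e he => (mem_filter.mp he).2), ?_⟩
  · exact (card_union_le _ _).trans (by omega)
  · refine ⟨?_, ?_, ?_, ?_⟩
    · rw [disjoint_union_left]
      exact ⟨hs.disj.mono_right sdiff_subset, disjoint_sdiff⟩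
    · intro v hv
      refine hs.untouched v ?_
      rw [union_assoc, union_sdiff_of_subset hG] at hv
      exact hv
    · intro v hv u huv hu
      rcases mem_union.mp hv with hv | hv
      · exact hB (hs.left v hv u huv hu)
      · by_cases huj : (u : ℕ) < j * h
        · exact hB (hs.right v (hG hv) u huv huj)
        · by_cases hvB : s(v, u) ∈ B
          · exact hB hvB
          · refine mem_union_right _ (mem_filter.mpr ⟨mem_free.mpr ⟨?_, ?_, hvB⟩, ?_⟩)
            · simpa using huv.symm
            · intro hM
              exact hs.untouched v (mem_union_right _ (hG hv)) _ hM (by simp)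
            · simp only [mk_mem_sym2_iff, mem_union]
              exact ⟨Or.inr hv, Or.inl (by simp [U]; omega)⟩
    · intro v hv u huv hu
      exact hB (hs.right v (mem_sdiff.mp hv).1 u huv hu)

lemma Sweep.maker_step {n h j : ℕ} {P Q : Finset (Fin n)} {M B : Finset (Sym2 (Fin n))}
    (hs : Sweep h j P Q ⟨M, B, .maker⟩) (e : Sym2 (Fin n)) :
    Sweep h j (P \ e.toFinset) (Q \ e.toFinset) ⟨insert e M, B, .breaker⟩ := by
  refine ⟨hs.disj.mono sdiff_subset sdiff_subset, ?_, fun v hv => hs.left v (mem_sdiff.mp hv).1,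
    fun v hv => hs.right v (mem_sdiff.mp hv).1⟩
  intro v hv f hf
  rw [← union_sdiff_distrib, mem_sdiff] at hv
  rcases mem_insert.mp hf with rfl | hf
  · simpa using hv.2
  · exact hs.untouched v hv.1 f hf

lemma card_add_card_le_sdiff {α : Type*} [DecidableEq α] {P Q E : Finset α} (hPQ : Disjoint P Q)
    (hE : E.card ≤ 2) {q : ℝ} (hq1 : q ≤ 1) :
    (P.card : ℝ) + q * Q.card ≤ (P \ E).card + q * (Q \ E).card + 2 := by
  have h1 := card_sdiff_add_card_inter P E
  have h2 := card_sdiff_add_card_inter Q E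
  have h3 : (P ∩ E).card + (Q ∩ E).card ≤ 2 := by
    rw [← card_union_of_disjoint (hPQ.mono inter_subset_left inter_subset_left),
      ← union_inter_distrib_right]
    exact (card_le_card inter_subset_right).trans hE
  have h1' : ((P \ E).card : ℝ) + (P ∩ E).card = P.card := by exact_mod_cast h1
  have h2' : ((Q \ E).card : ℝ) + (Q ∩ E).card = Q.card := by exact_mod_cast h2
  have h3' : ((P ∩ E).card : ℝ) + (Q ∩ E).card ≤ 2 := by exact_mod_cast h3
  have h4 : (0 : ℝ) ≤ (Q ∩ E).card := by positivity
  rw [← h1', ← h2']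
  nlinarith

/-- Breaker wins by isolating a vertex. -/
theorem breaker_wins {n m h r : ℕ} (first : Player) (hn : 2 ≤ n) (hh : 2 ≤ h) (hm : 2 * h ≤ m)
    (hr : n ≤ r * h) (hK : 2 * ((r : ℝ) + 1) < (1 - 2 / (h : ℝ)) ^ (r + 1) * n) :
    WinsCliqueConnectivity n m first .breaker := by
  classical
  have hh' : (2 : ℝ) ≤ h := by exact_mod_cast hh
  obtain ⟨q, hq⟩ : ∃ q : ℝ, q = 1 - 2 / (h : ℝ) := ⟨_, rfl⟩
  have hq1 : q ≤ 1 := by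
    have : 0 ≤ 2 / (h : ℝ) := by positivity
    linarith
  have hq0 : 0 ≤ q := by
    rw [hq]
    have : 2 / (h : ℝ) ≤ 1 := by rw [div_le_one (by linarith)]; exact hh'
    linarith
  -- In the measure |P| + q|Q|, moving h vertices from `Q` to `P` gains exactly the 2 that Maker's
  -- reply can destroy.
  have hqh : (1 - q) * h = 2 := by rw [hq]; field_simp; ring
  rw [← hq] at hK
  -- `K j` is the guaranteed value of |P| + q|Q| in stage j. Each new stage multiplies by q and
  -- loses at most 2 more, for the last, possibly incomplete, group.
  obtain ⟨K, hKdef⟩ : ∃ K : ℕ → ℝ, ∀ j, K j = q ^ (j + 1) * n - 2 * ((j : ℝ) + 1) :=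
    ⟨fun j => q ^ (j + 1) * n - 2 * ((j : ℝ) + 1), fun _ => rfl⟩
  have hKpos : ∀ j ≤ r, 0 < K j := by
    intro j hj
    have h1 : q ^ (r + 1) ≤ q ^ (j + 1) := pow_le_pow_of_le_one hq0 hq1 (by omega)
    have h2 : (j : ℝ) ≤ r := by exact_mod_cast hj
    have h3 : q ^ (r + 1) * n ≤ q ^ (j + 1) * n := by gcongr
    rw [hKdef]
    linarith
  have hKsucc : ∀ j, K (j + 1) + 2 ≤ q * K j := by
    intro j
    rw [hKdef, hKdef]
    have : q * (2 * ((j : ℝ) + 1)) ≤ 1 * (2 * ((j : ℝ) + 1)) := by gcongr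
    push_cast
    have e : q * (q ^ (j + 1) * n - 2 * ((j : ℝ) + 1)) =
      q ^ (j + 1 + 1) * n - q * (2 * ((j : ℝ) + 1)) := by ring
    rw [e]; linarith
  -- The credit of 2 held on Maker's turn pays for the two endpoints of her edge. At the start q·n =
  -- K 0 + 2, so either player may begin.
  let extra : Player → ℝ := fun P => match P with | .maker => 2 | .breaker => 0
  have hextra : ∀ P, 0 ≤ extra P := by rintro (_ | _) <;> simp [extra]
  let Inv : Position n → Prop := fun p => (∃ v, p.Isolated v) ∨
    ∃ j P Q, j ≤ r ∧ Sweep h j P Q p ∧ K j + extra p.turn ≤ P.card + q * Q.card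
  have hne : ∀ {j : ℕ} {P Q : Finset (Fin n)} {x : ℝ}, j ≤ r → 0 ≤ x →
      K j + x ≤ P.card + q * Q.card → ∃ v, v ∈ P ∪ Q := by
    intro j P Q x hj hx hle
    by_contra hcon
    have hPQ : P ∪ Q = ∅ := eq_empty_of_forall_notMem (not_exists.mp hcon)
    obtain ⟨rfl, rfl⟩ := union_eq_empty.mp hPQ
    have := hKpos j hj
    simp at hle
    linarith
  refine wins_of_invariant Inv ?_ ?_ ?_ ?_
  · refine Or.inr ⟨0, ∅, univ, Nat.zero_le _, ⟨by simp, ?_, by simp, by simp⟩, ?_⟩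
    · simp [Position.init]
    · rw [hKdef]
      have : extra (Position.init n first).turn ≤ 2 := by cases first <;> simp [extra, Position.init]
      simp
      linarith
  · rintro ⟨M, B, _ | _⟩ hp hfree hI
    · cases hp
    · rcases hI with ⟨v, hv⟩ | ⟨j, P, Q, hj, hs, hle⟩
      · obtain ⟨q, hq⟩ := exists_cliqueStep m _ hfree
        exact ⟨q, hq, Or.inl ⟨v, hq.isolated hv⟩⟩
      · by_cases hjr : n ≤ j * h
        · obtain ⟨v, hv⟩ := hne hj (hextra .breaker) hle
          obtain ⟨q, hq⟩ := exists_cliqueStep m _ hfree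
          exact ⟨q, hq, Or.inl ⟨v, hq.isolated (hs.isolated hjr hv)⟩⟩
        · have hjr' : j + 1 ≤ r := by
            by_contra hcon
            have : j = r := by omega
            exact hjr (this ▸ hr)
          simp only [extra, add_zero] at hle
          by_cases hQ : h ≤ Q.card
          · obtain ⟨G, hG, hGc⟩ := exists_subset_card_eq hQ
            obtain ⟨B', hstep, hs'⟩ := hs.breaker_move hm hG hGc.le hfree
            refine ⟨_, hstep, Or.inr ⟨j, _, _, hj, hs', ?_⟩⟩
            have h1 : ((P ∪ G).card : ℝ) = P.card + h := by
              rw [card_union_of_disjoint (hs.disj.mono_right hG), hGc]; push_cast; rfl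
            have h2 : ((Q \ G).card : ℝ) = Q.card - h := by
              rw [card_sdiff_of_subset hG, hGc, Nat.cast_sub hQ]
            simp only [extra]
            rw [h1, h2]
            linarith
          -- Fewer than h vertices remain in `Q`: one move finishes the block and opens the next
          -- stage.
          · obtain ⟨B', hstep, hs'⟩ := hs.breaker_move hm subset_rfl (by omega) hfree
            rw [sdiff_self] at hs'
            refine ⟨_, hstep, Or.inr ⟨j + 1, _, _, hjr', Sweep.next hs', ?_⟩⟩
            simp only [extra]
            rw [card_union_of_disjoint hs.disj]
            have h1 : K j ≤ (P.card : ℝ) + Q.card := by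
              have : q * (Q.card : ℝ) ≤ 1 * Q.card := by gcongr
              linarith
            have h2 := mul_le_mul_of_nonneg_left h1 hq0
            have h3 := hKsucc j
            push_cast
            simp
            linarith
  · intro p q' hp hstep hI
    rcases hI with ⟨v, hv⟩ | ⟨j, P, Q, hj, hs, hle⟩
    · exact Or.inl ⟨v, hstep.isolated hv⟩
    · cases hstep with
      | breaker => exact absurd rfl hp
      | maker M B e he =>
        refine Or.inr ⟨j, _, _, hj, hs.maker_step e, ?_⟩
        have := card_add_card_le_sdiff hs.disj (E := e.toFinset) ?_ hq1
        · simp only [extra] at hle ⊢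
          linarith
        · by_cases hd : e.IsDiag
          · rw [Sym2.card_toFinset_of_isDiag e hd]; omega
          · rw [Sym2.card_toFinset_of_not_isDiag e hd]
  · rintro p - (⟨v, hv⟩ | ⟨j, P, Q, hj, hs, hle⟩)
    · exact not_hasSpanningTree_of_untouched hn hv.1
    · obtain ⟨v, hv⟩ := hne hj (hextra p.turn) hle
      exact not_hasSpanningTree_of_untouched hn (hs.untouched v hv)

end MakerBreaker

/-! ### Maker hits every cut: the potential method. -/

namespace MakerBreaker
open Finset

/-- The edges of `K_n` between `S` and its complement. -/
def cut {n : ℕ} (S : Finset (Fin n)) : Finset (Sym2 (Fin n)) :=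
  (S ×ˢ Sᶜ).image fun x => s(x.1, x.2)

lemma not_isDiag_of_mem_cut {n : ℕ} {S : Finset (Fin n)} {e : Sym2 (Fin n)} (he : e ∈ cut S) :
    ¬ e.IsDiag := by
  obtain ⟨⟨u, v⟩, huv, rfl⟩ := mem_image.mp he
  simp only [mem_product, mem_compl] at huv
  simp only [Sym2.mk_isDiag_iff]
  rintro rfl
  exact huv.2 huv.1

lemma card_cut {n : ℕ} (S : Finset (Fin n)) : (cut S).card = S.card * (n - S.card) := by
  rw [cut, card_image_of_injOn, card_product, card_compl, Fintype.card_fin]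
  rintro ⟨a, b⟩ hab ⟨c, d⟩ hcd h
  simp only [coe_product, Set.mem_prod, mem_coe, mem_compl] at hab hcd
  rcases Sym2.eq_iff.mp h with ⟨h1, h2⟩ | ⟨h1, h2⟩
  · exact Prod.ext h1 h2
  · dsimp only at h1 h2
    subst h1
    exact absurd hab.1 hcd.2

/-- If Maker has an edge in every cut, then she owns a spanning tree. -/
lemma hasSpanningTree_of_cuts {n : ℕ} (hn : 1 ≤ n) {p : Position n}
    (h : ∀ S : Finset (Fin n), S.Nonempty → S ≠ univ → ∃ e ∈ cut S, e ∈ p.makerEdges) :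
    p.HasSpanningTree := by
  classical
  let G : SimpleGraph (Fin n) := SimpleGraph.fromEdgeSet (p.makerEdges : Set (Sym2 (Fin n)))
  have : Nonempty (Fin n) := ⟨⟨0, hn⟩⟩
  have hG : G.Connected := by
    refine ⟨fun u v => ?_⟩
    by_contra huv
    let S : Finset (Fin n) := univ.filter fun w => G.Reachable u w
    obtain ⟨e, he, heM⟩ := h S ⟨u, by simp [S]⟩ (fun hS => huv (by
      have : v ∈ S := hS ▸ mem_univ v
      simpa [S] using this))
    have hd := not_isDiag_of_mem_cut he
    obtain ⟨⟨a, b⟩, hab, rfl⟩ := mem_image.mp he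
    simp only [mem_product, mem_compl, S, mem_filter, mem_univ, true_and] at hab
    refine hab.2 (hab.1.trans (SimpleGraph.Adj.reachable ?_))
    rw [SimpleGraph.fromEdgeSet_adj]
    exact ⟨by simpa using heM, by simpa using hd⟩
  obtain ⟨T, hTG, hT⟩ := hG.exists_isTree_le
  refine ⟨T, hT, (SimpleGraph.edgeSet_mono hTG).trans ?_⟩
  rw [SimpleGraph.edgeSet_fromEdgeSet]
  exact Set.sdiff_subset

/-- The members of the set family `𝓕` that are disjoint from `M`. -/
def alive {α : Type*} [DecidableEq α] (𝓕 : Finset (Finset α)) (M : Finset α) :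
    Finset (Finset α) :=
  𝓕.filter fun F => Disjoint F M

/-- The weight of a set `F` when the elements of `B` have been claimed by the opponent, who claims
at most `b` elements in each turn. -/
noncomputable def weight {α : Type*} [DecidableEq α] (b : ℝ) (B F : Finset α) : ℝ :=
  (2 : ℝ) ^ (-((F \ B).card : ℝ) / b)

noncomputable def potential {α : Type*} [DecidableEq α] (𝓕 : Finset (Finset α)) (b : ℝ)
    (M B : Finset α) : ℝ :=
  ∑ F ∈ alive 𝓕 M, weight b B F

/-- The total weight of the sets that are still alive and contain `e`. -/
noncomputable def danger {α : Type*} [DecidableEq α] (𝓕 : Finset (Finset α)) (b : ℝ)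
    (M B : Finset α) (e : α) : ℝ :=
  ∑ F ∈ (alive 𝓕 M).filter (e ∈ ·), weight b B F

section
variable {α : Type*} [DecidableEq α] {𝓕 : Finset (Finset α)} {b : ℝ} {M B : Finset α}

lemma weight_nonneg (b : ℝ) (B F : Finset α) : 0 ≤ weight b B F := by
  unfold weight; positivity

lemma danger_nonneg (e : α) : 0 ≤ danger 𝓕 b M B e := sum_nonneg fun _ _ => weight_nonneg ..

lemma danger_le_potential (e : α) : danger 𝓕 b M B e ≤ potential 𝓕 b M B :=
  sum_le_sum_of_subset_of_nonneg (filter_subset _ _) fun _ _ _ => weight_nonneg ..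

lemma alive_insert (e : α) : alive 𝓕 (insert e M) = (alive 𝓕 M).filter (e ∉ ·) := by
  ext F
  simp only [alive, mem_filter, disjoint_insert_right]
  tauto

lemma potential_insert (e : α) :
    potential 𝓕 b (insert e M) B + danger 𝓕 b M B e = potential 𝓕 b M B := by
  rw [potential, danger, potential, alive_insert, add_comm]
  exact sum_filter_add_sum_filter_not _ _ _

lemma danger_insert_le (e f : α) : danger 𝓕 b (insert e M) B f ≤ danger 𝓕 b M B f := by
  refine sum_le_sum_of_subset_of_nonneg (filter_subset_filter _ ?_) fun _ _ _ => weight_nonneg ..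
  rw [alive_insert]
  exact filter_subset _ _

/-- With t = |F ∩ A| / b ≤ 1 the weight grows by a factor of at most 2^t ≤ 1 + t, by Bernoulli. This
linear bound makes the increase of the potential a sum of dangers. -/
lemma weight_union_le (hb : 0 < b) {A : Finset α} (hA : (A.card : ℝ) ≤ b) (F : Finset α) :
    weight b (B ∪ A) F ≤ weight b B F * (1 + ((F ∩ A).card : ℝ) / b) := by
  have hle : ((F ∩ A).card : ℝ) / b ≤ 1 := by
    rw [div_le_one hb]
    refine le_trans ?_ hA
    exact_mod_cast card_le_card inter_subset_right
  have h1 : (2 : ℝ) ^ (((F ∩ A).card : ℝ) / b) ≤ 1 + ((F ∩ A).card : ℝ) / b := by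
    have := rpow_one_add_le_one_add_mul_self (s := 1) (by norm_num)
      (p := ((F ∩ A).card : ℝ) / b) (by positivity) hle
    rw [mul_one] at this
    convert this using 2
    norm_num
  have hcard : (F \ B).card ≤ (F \ (B ∪ A)).card + (F ∩ A).card := by
    refine le_trans (card_le_card fun x hx => ?_) (card_union_le _ _)
    simp only [mem_union, mem_sdiff, mem_inter] at hx ⊢
    tauto
  have hcard' : ((F \ B).card : ℝ) ≤ (F \ (B ∪ A)).card + (F ∩ A).card := by exact_mod_cast hcard
  calc weight b (B ∪ A) F
      ≤ (2 : ℝ) ^ (-((F \ B).card : ℝ) / b + ((F ∩ A).card : ℝ) / b) := by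
        unfold weight
        refine Real.rpow_le_rpow_of_exponent_le (by norm_num) ?_
        rw [← add_div]
        gcongr
        linarith
    _ = weight b B F * (2 : ℝ) ^ (((F ∩ A).card : ℝ) / b) := by
        rw [Real.rpow_add (by norm_num)]; rfl
    _ ≤ _ := mul_le_mul_of_nonneg_left h1 (weight_nonneg ..)

lemma sum_danger (A : Finset α) :
    ∑ e ∈ A, danger 𝓕 b M B e = ∑ F ∈ alive 𝓕 M, weight b B F * (F ∩ A).card := by
  simp only [danger, sum_filter]
  rw [sum_comm]
  refine sum_congr rfl fun F _ => ?_
  rw [← sum_filter, sum_const, nsmul_eq_mul, mul_comm, filter_mem_eq_inter, inter_comm]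

lemma potential_union_le (hb : 0 < b) {A : Finset α} (hA : (A.card : ℝ) ≤ b) :
    potential 𝓕 b M (B ∪ A) ≤ potential 𝓕 b M B + (∑ e ∈ A, danger 𝓕 b M B e) / b := by
  rw [sum_danger, potential, potential, sum_div, ← sum_add_distrib]
  refine sum_le_sum fun F _ => (weight_union_le hb hA F).trans (le_of_eq ?_)
  ring

/-- The increase is at most the sum of |A| ≤ b dangers divided by b, hence at most the largest
danger in `A`. -/
lemma potential_union_lt (hb : 0 < b) {A : Finset α} (hA : (A.card : ℝ) ≤ b) {c : ℝ}
    (h0 : potential 𝓕 b M B < c)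
    (h : ∀ e ∈ A, potential 𝓕 b M B + danger 𝓕 b M B e < c) :
    potential 𝓕 b M (B ∪ A) < c := by
  rcases A.eq_empty_or_nonempty with rfl | hne
  · simpa using h0
  obtain ⟨e, he, hmax⟩ := exists_max_image A (danger 𝓕 b M B) hne
  have h1 : (∑ f ∈ A, danger 𝓕 b M B f) / b ≤ danger 𝓕 b M B e := by
    rw [div_le_iff₀ hb]
    calc _ ≤ A.card • danger 𝓕 b M B e := sum_le_card_nsmul _ _ _ hmax
      _ ≤ _ := by
        rw [nsmul_eq_mul, mul_comm]
        exact mul_le_mul_of_nonneg_left hA (danger_nonneg e)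
  linarith [potential_union_le (𝓕 := 𝓕) (M := M) (B := B) hb hA, h e he]

end

/-- The family of all cuts of `K_n`. -/
def cuts (n : ℕ) : Finset (Finset (Sym2 (Fin n))) :=
  (univ.filter fun S : Finset (Fin n) => S.Nonempty ∧ S ≠ univ).image cut

/-- The biased Erdős–Selfridge criterion for the cut family: Maker claims an edge in every cut. -/
theorem maker_wins_of_potential {n m : ℕ} (first : Player) (hn : 1 ≤ n) {b : ℝ} (hb : 0 < b)
    (hm : (m : ℝ) ^ 2 ≤ b) (hpot : potential (cuts n) b ∅ ∅ < 1 / 2) :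
    WinsCliqueConnectivity n m first .maker := by
  let Inv : Position n → Prop := fun p =>
    potential (cuts n) b p.makerEdges p.breakerEdges < 1 ∧ (p.turn = .breaker →
      ∀ e, potential (cuts n) b p.makerEdges p.breakerEdges
        + danger (cuts n) b p.makerEdges p.breakerEdges e < 1 ∨ e ∉ p.free)
  refine wins_of_invariant Inv ?_ ?_ ?_ ?_
  -- Starting below 1/2 covers Breaker moving first, since a danger never exceeds the potential.
  · refine ⟨lt_trans hpot (by norm_num), fun _ e => Or.inl ?_⟩
    have := danger_le_potential (𝓕 := cuts n) (b := b) (M := ∅) (B := ∅) e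
    simp only [Position.init]
    linarith
  · rintro ⟨M, B, _ | _⟩ hp hfree hI
    -- Maker takes the most dangerous free edge: the potential drops by its danger, which is at
    -- least the danger of any edge still free.
    · obtain ⟨e, he, hmax⟩ := exists_max_image _ (danger (cuts n) b M B) hfree
      refine ⟨_, .maker M B e he, ?_, fun _ f => ?_⟩
      · have := potential_insert (𝓕 := cuts n) (b := b) (M := M) (B := B) e
        have := danger_nonneg (𝓕 := cuts n) (b := b) (M := M) (B := B) e
        have := hI.1
        dsimp only at *
        linarith
      · by_cases hf : f ∈ (Position.mk M B .maker).free
        · left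
          have := potential_insert (𝓕 := cuts n) (b := b) (M := M) (B := B) e
          have := danger_insert_le (𝓕 := cuts n) (b := b) (M := M) (B := B) e f
          have := hmax f hf
          have := hI.1
          dsimp only at *
          linarith
        · right
          rw [mem_free] at hf ⊢
          simp only [mem_insert] at hf ⊢
          tauto
    · cases hp
  · intro p q hp hstep hI
    cases hstep with
    | maker => exact absurd rfl hp
    | breaker M B A S hfree hA hS hAS =>
      refine ⟨potential_union_lt hb ?_ hI.1 fun e he => (hI.2 rfl e).resolve_right
        (not_not.mpr (hA he)), fun h => by cases h⟩
      refine le_trans ?_ hm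
      have h1 : A.card ≤ (S.card + 1).choose 2 := (card_le_card hAS).trans (card_sym2 S).le
      have h2 : (S.card + 1).choose 2 ≤ m ^ 2 := by
        refine (Nat.choose_le_choose 2 (Nat.succ_le_succ hS)).trans ?_
        rw [Nat.choose_two_right, Nat.succ_sub_one]
        refine Nat.div_le_of_le_mul ?_
        rcases Nat.eq_zero_or_pos m with rfl | h
        · simp
        · nlinarith
      exact_mod_cast h1.trans h2
  · intro p hfree hI
    refine hasSpanningTree_of_cuts hn fun S hS hS' => ?_
    by_contra! hcon
    have hmem : cut S ∈ alive (cuts n) p.makerEdges := by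
      refine mem_filter.mpr ⟨mem_image.mpr ⟨S, by simp [hS, hS'], rfl⟩, ?_⟩
      exact disjoint_left.mpr hcon
    -- A cut wholly owned by Breaker has weight 2^0 = 1, contradicting potential below 1.
    have hw : weight b p.breakerEdges (cut S) = 1 := by
      have : cut S \ p.breakerEdges = ∅ := by
        rw [sdiff_eq_empty_iff_subset]
        intro e he
        by_contra heB
        have : e ∈ p.free := mem_free.mpr ⟨not_isDiag_of_mem_cut he, hcon e he, heB⟩
        simp [hfree] at this
      simp [weight, this]
    have := single_le_sum (f := weight b p.breakerEdges) (fun F _ => weight_nonneg ..) hmem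
    have := hI.1
    unfold potential at this
    linarith

/-- If k is the size of the smaller side, the cut has k(n - k) ≥ nk/2 edges, so its weight is at
most x^k. Adding the terms of both sides avoids asking which is smaller, and the binomial theorem
sums each. -/
lemma potential_cuts_le {n : ℕ} {b : ℝ} (hb : 0 < b) :
    potential (cuts n) b ∅ ∅ ≤ 2 * ((1 + (2 : ℝ) ^ (-(n : ℝ) / (2 * b))) ^ n - 1) := by
  classical
  obtain ⟨x, hx⟩ : ∃ x : ℝ, x = (2 : ℝ) ^ (-(n : ℝ) / (2 * b)) := ⟨_, rfl⟩
  have hx0 : 0 ≤ x := by rw [hx]; positivity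
  rw [← hx]
  have halive : alive (cuts n) ∅ = cuts n := by simp [alive]
  have key : ∀ k : ℕ, ∀ N : ℕ, ((n : ℝ) * k) / 2 ≤ N → (2 : ℝ) ^ (-(N : ℝ) / b) ≤ x ^ k := by
    intro k N h
    rw [hx, ← Real.rpow_natCast, ← Real.rpow_mul (by norm_num)]
    refine Real.rpow_le_rpow_of_exponent_le (by norm_num) ?_
    have : -(n : ℝ) / (2 * b) * k = -((n : ℝ) * k / 2) / b := by field_simp
    rw [this]
    gcongr
  have hterm : ∀ S : Finset (Fin n), weight b ∅ (cut S) ≤ x ^ S.card + x ^ (Sᶜ).card := by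
    intro S
    have hS : S.card + (Sᶜ).card = n := by simp
    have hc : (cut S).card = S.card * (Sᶜ).card := by
      rw [card_cut]; congr 1; omega
    have hS' : (S.card : ℝ) + (Sᶜ).card = n := by exact_mod_cast hS
    rw [weight, sdiff_empty]
    have p1 := pow_nonneg hx0 S.card
    have p2 := pow_nonneg hx0 (Sᶜ).card
    rcases le_total (S.card : ℝ) (Sᶜ).card with h | h
    · have := key S.card (cut S).card (by rw [hc]; push_cast; nlinarith)
      linarith
    · have := key (Sᶜ).card (cut S).card (by rw [hc]; push_cast; nlinarith)
      linarith
  let 𝓢 : Finset (Finset (Fin n)) := univ.filter fun S => S.Nonempty ∧ S ≠ univ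
  have hsum : ∑ S : Finset (Fin n), x ^ S.card = (1 + x) ^ n := by
    have := Fintype.sum_pow_mul_eq_add_pow (Fin n) x (1 : ℝ)
    simp only [one_pow, mul_one, Fintype.card_fin] at this
    rw [this, add_comm]
  have h1 : ∑ S ∈ 𝓢, x ^ S.card ≤ (1 + x) ^ n - 1 := by
    rw [← hsum, ← add_sum_erase univ _ (mem_univ (∅ : Finset (Fin n)))]
    simp only [card_empty, pow_zero, add_sub_cancel_left]
    refine sum_le_sum_of_subset_of_nonneg (fun S hS => ?_) fun _ _ _ => by positivity
    simp only [𝓢, mem_filter] at hS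
    simpa [nonempty_iff_ne_empty] using hS.2.1.ne_empty
  have h2 : ∑ S ∈ 𝓢, x ^ (Sᶜ).card = ∑ S ∈ 𝓢, x ^ S.card := by
    refine sum_nbij' (fun S => Sᶜ) (fun S => Sᶜ) ?_ ?_ (by simp) (by simp) (by simp) <;>
    · intro S hS
      simp only [𝓢, mem_filter, mem_univ, true_and, nonempty_iff_ne_empty, ne_eq,
        compl_eq_empty_iff, compl_eq_univ_iff] at hS ⊢
      exact hS.symm
  calc potential (cuts n) b ∅ ∅ ≤ ∑ S ∈ 𝓢, weight b ∅ (cut S) := by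
        rw [potential, halive, cuts]
        exact sum_image_le_of_nonneg fun _ _ => weight_nonneg ..
    _ ≤ ∑ S ∈ 𝓢, (x ^ S.card + x ^ (Sᶜ).card) := sum_le_sum fun S _ => hterm S
    _ ≤ _ := by rw [sum_add_distrib, h2]; linarith

/-- Maker wins if the bias is at most a small multiple of `√(n / log n)`. -/
theorem maker_wins {n m : ℕ} (first : Player) (hn : 9 ≤ n)
    (hm : (m : ℝ) ^ 2 ≤ n / (8 * Real.log n)) : WinsCliqueConnectivity n m first .maker := by
  have hn' : (9 : ℝ) ≤ n := by exact_mod_cast hn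
  have hlog : 0 < Real.log n := Real.log_pos (by linarith)
  have hb : 0 < (n : ℝ) / (8 * Real.log n) := by positivity
  refine maker_wins_of_potential first (by omega) hb hm ((potential_cuts_le hb).trans_lt ?_)
  -- The left side is n^(-4 log 2), and log 2 > 1/2.
  have hx : (2 : ℝ) ^ (-(n : ℝ) / (2 * (n / (8 * Real.log n)))) ≤ 1 / (n : ℝ) ^ 2 := by
    have e : -(n : ℝ) / (2 * (n / (8 * Real.log n))) = -(4 * Real.log n) := by field_simp; norm_num
    rw [e, Real.rpow_def_of_pos (by norm_num)]
    have e2 : 1 / (n : ℝ) ^ 2 = Real.exp (-(2 * Real.log n)) := by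
      rw [Real.exp_neg, mul_comm, Real.exp_mul, Real.exp_log (by linarith), one_div]
      norm_num
    rw [e2, Real.exp_le_exp]
    nlinarith [Real.log_two_gt_d9]
  have h1 : (1 + (2 : ℝ) ^ (-(n : ℝ) / (2 * (n / (8 * Real.log n))))) ^ n ≤ Real.exp (1 / n) := by
    calc _ ≤ (1 + 1 / (n : ℝ) ^ 2) ^ n := by gcongr
      _ ≤ (Real.exp (1 / (n : ℝ) ^ 2)) ^ n := by
        gcongr
        rw [add_comm]; exact Real.add_one_le_exp _
      _ = _ := by rw [← Real.exp_nat_mul]; congr 1; field_simp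
  have h2 : Real.exp (1 / (n : ℝ)) ≤ Real.exp (1 / 9) := by gcongr
  have h3 : Real.exp (1 / 9) < 5 / 4 := by
    have := Real.exp_bound_div_one_sub_of_interval (x := 1 / 9) (by norm_num) (by norm_num)
    norm_num at this ⊢
    linarith
  linarith

end MakerBreaker

/-! ### Asymptotics and the threshold. -/

namespace MakerBreaker
open Filter Topology

/-- The order of magnitude of the threshold bias. -/
noncomputable def thresholdScale (n : ℕ) : ℝ := Real.sqrt ((n : ℝ) / Real.log n)

lemma thresholdScale_sq_mul_log {n : ℕ} (hn : 2 ≤ n) :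
    thresholdScale n ^ 2 * Real.log n = n := by
  have hn' : (2 : ℝ) ≤ n := by exact_mod_cast hn
  have hlog : 0 < Real.log n := Real.log_pos (by linarith)
  rw [thresholdScale, Real.sq_sqrt (by positivity)]
  field_simp

lemma tendsto_thresholdScale : Tendsto thresholdScale atTop atTop := by
  refine Real.tendsto_sqrt_atTop.comp ?_
  have h : Tendsto (fun n : ℕ => Real.sqrt n / 2) atTop atTop :=
    (Real.tendsto_sqrt_atTop.comp tendsto_natCast_atTop_atTop).atTop_div_const (by norm_num)
  refine tendsto_atTop_mono' _ ?_ h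
  filter_upwards [eventually_ge_atTop 2] with n hn
  have hn' : (2 : ℝ) ≤ n := by exact_mod_cast hn
  have hlog : 0 < Real.log n := Real.log_pos (by linarith)
  have hs : 0 < Real.sqrt n := Real.sqrt_pos.mpr (by linarith)
  have h1 : Real.log n ≤ 2 * Real.sqrt n := by
    have := Real.log_le_sub_one_of_pos hs
    rw [Real.log_sqrt (by linarith)] at this
    linarith
  rw [le_div_iff₀ hlog]
  nlinarith [Real.sq_sqrt (show (0 : ℝ) ≤ n by linarith)]

/-- Breaker wins if the bias is at least a large multiple of `√(n / log n)`. -/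
theorem breaker_wins_of_large {n m : ℕ} (first : Player) (hs : 2 ≤ thresholdScale n)
    (hL : 60 ≤ Real.log n) (hm : 2 * ⌈4 * thresholdScale n⌉₊ ≤ m) :
    WinsCliqueConnectivity n m first .breaker := by
  have hn2 : 2 ≤ n := by
    by_contra hcon
    have : n = 0 ∨ n = 1 := by omega
    rcases this with rfl | rfl <;> norm_num at hL
  have hsq := thresholdScale_sq_mul_log hn2
  obtain ⟨s, hsdef⟩ : ∃ s, s = thresholdScale n := ⟨_, rfl⟩
  obtain ⟨L, hLdef⟩ : ∃ L, L = Real.log n := ⟨_, rfl⟩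
  obtain ⟨h, hhdef⟩ : ∃ h, h = ⌈4 * thresholdScale n⌉₊ := ⟨_, rfl⟩
  rw [← hhdef] at hm
  have hh4 : 4 * s ≤ h := by rw [hsdef, hhdef]; exact Nat.le_ceil _
  rw [← hsdef] at hs hsq
  rw [← hLdef] at hL hsq
  have hhpos : (0 : ℝ) < h := by linarith
  have hh2 : 2 ≤ h := by
    have : (2 : ℝ) ≤ h := by linarith
    exact_mod_cast this
  have hnexp : (n : ℝ) = Real.exp L := by
    rw [hLdef, Real.exp_log]
    exact_mod_cast (by omega : 0 < n)
  have hr1 : (((n / h + 1 : ℕ) : ℝ) + 1) ≤ s * L / 4 + 2 := by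
    have h1 : ((n / h : ℕ) : ℝ) ≤ n / h := Nat.cast_div_le
    have h2 : (n : ℝ) / h ≤ s * L / 4 := by
      rw [div_le_iff₀ hhpos, ← hsq]
      have := mul_le_mul_of_nonneg_left hh4 (show 0 ≤ s * L / 4 by positivity)
      linarith
    push_cast
    linarith
  refine breaker_wins (h := h) (r := n / h + 1) first hn2 hh2 hm ?_ ?_
  · exact (Nat.lt_mul_of_div_lt (Nat.lt_succ_self _) (by omega)).le
  have hq : Real.exp (-(1 / s)) ≤ 1 - 2 / (h : ℝ) := by
    have h1 : 2 / (h : ℝ) ≤ 1 / (2 * s) := by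
      rw [div_le_div_iff₀ hhpos (by linarith)]
      linarith
    have h2 : 1 / s ≤ 1 / 2 := one_div_le_one_div_of_le (by norm_num) hs
    have h0 : 0 < 1 / s := by positivity
    have h3 : Real.exp (-(1 / s)) ≤ 1 - (1 / s) / 2 := by
      rw [Real.exp_neg, inv_le_comm₀ (Real.exp_pos _) (by linarith)]
      refine le_trans ?_ (Real.add_one_le_exp _)
      rw [inv_le_comm₀ (by linarith) (by linarith), inv_le_iff_one_le_mul₀ (by linarith)]
      nlinarith
    have h4 : 1 / (2 * s) = (1 / s) / 2 := by field_simp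
    linarith
  -- There are at most sL/4 + 2 factors, each at least exp(-1/s). So about n^(3/4) vertices survive,
  -- against a loss of order sL ≤ √n · log n.
  have hpow : Real.exp (-(L / 4) - 1) ≤ (1 - 2 / (h : ℝ)) ^ (n / h + 1 + 1) := by
    refine le_trans ?_ (pow_le_pow_left₀ (Real.exp_pos _).le hq _)
    rw [← Real.exp_nat_mul, Real.exp_le_exp]
    have h1 : (((n / h + 1 + 1 : ℕ) : ℝ)) * (1 / s) ≤ (s * L / 4 + 2) * (1 / s) := by
      refine mul_le_mul_of_nonneg_right ?_ (by positivity)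
      push_cast at hr1 ⊢
      exact hr1
    have h2 : (s * L / 4 + 2) * (1 / s) = L / 4 + 2 * (1 / s) := by field_simp
    have h3 : 1 / s ≤ 1 / 2 := one_div_le_one_div_of_le (by norm_num) hs
    linarith
  have hsL : s * L ≤ Real.exp (L / 2) * L := by
    have h1 : s ≤ Real.exp (L / 2) := by
      refine le_of_sq_le_sq ?_ (Real.exp_pos _).le
      rw [← Real.exp_nat_mul]
      have : ((2 : ℕ) : ℝ) * (L / 2) = L := by push_cast; ring
      rw [this, ← hnexp, ← hsq]
      nlinarith [sq_nonneg s]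
    exact mul_le_mul_of_nonneg_right h1 (by linarith)
  have hbig : 3 * (L / 2 + 4) < Real.exp (L / 4) := by
    have := Real.quadratic_le_exp_of_nonneg (x := L / 4) (by linarith)
    nlinarith
  have hE : 1 ≤ Real.exp (L / 2) := Real.one_le_exp (by linarith)
  have hsplit : Real.exp (-(L / 4) - 1) * n = Real.exp (L / 2) * Real.exp (L / 4) / Real.exp 1 := by
    rw [hnexp, ← Real.exp_add, ← Real.exp_add, ← Real.exp_sub]
    congr 1
    ring
  have hlow : L / 2 + 4 < Real.exp (L / 4) / Real.exp 1 := by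
    rw [lt_div_iff₀ (Real.exp_pos _)]
    nlinarith [Real.exp_one_lt_d9]
  calc 2 * (((n / h + 1 : ℕ) : ℝ) + 1) ≤ 2 * (s * L / 4 + 2) := by linarith
    _ ≤ Real.exp (L / 2) * (L / 2 + 4) := by nlinarith
    _ < Real.exp (L / 2) * (Real.exp (L / 4) / Real.exp 1) := by gcongr
    _ = Real.exp (-(L / 4) - 1) * n := by rw [hsplit, mul_div_assoc]
    _ ≤ _ := by gcongr

end MakerBreaker

open MakerBreaker Filter Asymptotics in
theorem mainTheorem2 (first : Player) :
    ∃ m₀ : ℕ → ℕ,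
      (∀ᶠ n : ℕ in atTop, IsThresholdBias n first (m₀ n)) ∧
      (fun n : ℕ => (m₀ n : ℝ)) =Θ[atTop] (fun n : ℕ => Real.sqrt ((n : ℝ) / Real.log (n : ℝ))) := by
  classical
  let bound : ℕ → ℕ := fun n => 2 * ⌈4 * thresholdScale n⌉₊
  -- The search may stop at `bound n`, from which on Breaker wins outright.
  let m₀ : ℕ → ℕ := fun n =>
    Nat.findGreatest (fun m => WinsCliqueConnectivity n m first .maker) (bound n)
  have hlog : ∀ᶠ n : ℕ in atTop, 60 ≤ Real.log n :=
    (Real.tendsto_log_atTop.comp tendsto_natCast_atTop_atTop).eventually_ge_atTop 60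
  have hscale := tendsto_thresholdScale.eventually_ge_atTop 6
  have hmaker : ∀ᶠ n : ℕ in atTop, ∀ m : ℕ, (m : ℝ) ≤ thresholdScale n / 3 →
      WinsCliqueConnectivity n m first .maker := by
    filter_upwards [eventually_ge_atTop 9, hlog, hscale] with n hn hL hs m hm
    refine maker_wins first hn ?_
    have h1 := thresholdScale_sq_mul_log (n := n) (by omega)
    have h2 : (m : ℝ) ^ 2 ≤ (thresholdScale n / 3) ^ 2 := by gcongr
    rw [le_div_iff₀ (by linarith)]
    have h3 := mul_le_mul_of_nonneg_right h2 (show 0 ≤ 8 * Real.log n by linarith)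
    have h4 : (thresholdScale n / 3) ^ 2 * (8 * Real.log n) = 8 / 9 * n := by linear_combination 8 / 9 * h1
    have h5 : (0 : ℝ) ≤ n := by positivity
    linarith
  refine ⟨m₀, ?_, ?_⟩
  · filter_upwards [hlog, hscale, hmaker] with n hL hs hM m
    refine ⟨fun hm => ?_, fun hm => ?_⟩
    · refine WinsCliqueConnectivity.maker_anti hm ?_
      exact Nat.findGreatest_spec (P := fun m => WinsCliqueConnectivity n m first .maker)
        (Nat.zero_le _) (hM 0 (by push_cast; linarith))
    · by_cases hmb : m ≤ bound n
      · exact (maker_wins_or_breaker_wins n m first).resolve_left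
          (Nat.findGreatest_is_greatest hm hmb)
      · exact breaker_wins_of_large first (by linarith) hL (not_le.mp hmb).le
  -- For s ≥ 6: 2⌈4s⌉ ≤ 8s + 2 ≤ 9s, and ⌊s/3⌋ ≥ s/3 - 1 ≥ s/6.
  · refine ⟨IsBigO.of_bound 9 ?_, IsBigO.of_bound 6 ?_⟩
    · filter_upwards [hscale] with n hs
      have h1 : m₀ n ≤ bound n := Nat.findGreatest_le _
      have h2 : (m₀ n : ℝ) ≤ 2 * (⌈4 * thresholdScale n⌉₊ : ℝ) := by exact_mod_cast h1
      have h3 := (Nat.ceil_lt_add_one (show 0 ≤ 4 * thresholdScale n by linarith)).le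
      rw [Real.norm_of_nonneg (by positivity), Real.norm_of_nonneg (Real.sqrt_nonneg _)]
      change _ ≤ 9 * thresholdScale n
      linarith
    · filter_upwards [hscale, hmaker] with n hs hM
      have h0 : 0 ≤ thresholdScale n / 3 := by linarith
      have h1 : ⌊thresholdScale n / 3⌋₊ ≤ m₀ n := by
        refine Nat.le_findGreatest ?_ (hM _ (Nat.floor_le h0))
        have : (⌊thresholdScale n / 3⌋₊ : ℝ) ≤ bound n := by
          have h2 := Nat.floor_le h0
          have h3 := Nat.le_ceil (4 * thresholdScale n)
          simp only [bound]
          push_cast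
          linarith
        exact_mod_cast this
      have h2 : (⌊thresholdScale n / 3⌋₊ : ℝ) ≤ m₀ n := by exact_mod_cast h1
      have h3 := Nat.lt_floor_add_one (thresholdScale n / 3)
      rw [Real.norm_of_nonneg (Real.sqrt_nonneg _), Real.norm_of_nonneg (by positivity)]
      change thresholdScale n ≤ _
      linarith
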